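/- Let $\{X_t\}_{t\in\mathbb Z}$ be an i.i.d. sequence of real random variables on a probability space $(\Omega,\mathcal F,\mathbb P)$ whose common distribution function $F$ is invertible with inverse $Q$, i.e. for every $u\in(0,1)$ the equation $F(x)=u$ has the unique solution $x=Q(u)$. No moments of $X_t$ are assumed. Fix $0<p<q<1$ and put $A:=[Q(p),Q(q)]\times[Q(p),Q(q)]$. For random variables $X,Y$ with $\mathbb P[(X,Y)\in A]>0$ let $\mu_A(Z):=\mathbb E[Z\mid (X,Y)\in A]$ and $\sigma_A^2(Z):=\mathbb E[(Z-\mu_A(Z))^2\mid (X,Y)\in A]$ for $Z\in\{X,Y\}$, and let $$\mathrm{Cor}_A(X,Y):=\frac{\mathbb E[(X-\mu_A(X))(Y-\mu_A(Y))\mid (X,Y)\in A]}{\sqrt{\sigma_A^2(X)\,\sigma_A^2(Y)}} .$$ For an integer $h\ge 1$ let $\rho_A(h):=\mathrm{Cor}_A(X_t,X_{t+h})$ be the lag $h$ conditional autocorrelation, which does not depend on $t\in\mathbb Z$. For $n\ge1$ put $x_i:=X_i$, $y_i:=X_{i+h}$ for $i=1,\dots,n$, $N:=\sum_{i=1}^n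 1_A(x_i,y_i)$, $$\bar\mu(z):=\frac1N\sum_{i=1}^n z_i1_A(x_i,y_i),\qquad \bar\sigma^2(z):=\frac1N\sum_{i=1}^n (z_i-\bar\mu(z))^2\,1_A(x_i,y_i),$$ for $z=x$ or $z=y$, and let $$\bar\rho_A(h):=\frac{\frac1N\sum_{i=1}^n (x_i-\bar\mu(x))(y_i-\bar\mu(y))1_A(x_i,y_i)}{\sqrt{\bar\sigma^2(x)\,\bar\sigma^2(y)}}$$ be the conditional autocorrelation estimator with known set $A$, with the convention that a quotient with zero denominator is $0$. Then for every integer $h\ge1$ there is $\tau>0$ such that $$\sqrt n\,\bigl(\bar\rho_A(h)-\rho_A(h)\bigr)\overset{d}{\longrightarrow}\mathcal N(0,\tau),\qquad n\to\infty,$$ where $\mathcal N(0,\tau)$ is the normal distribution with mean $0$ and variance $\tau$. -/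

import Mathlib

open MeasureTheory ProbabilityTheory Filter Set
open scoped NNReal

noncomputable section

namespace CondCorr

/-! Population quantities, for a random vector `(X, Y)` and a conditioning set `A ⊆ ℝ²`. -/

section Population

variable {Ω : Type*} [MeasurableSpace Ω]

/-- The conditional mean `μ_A(Z) = E[Z | (X, Y) ∈ A]`. -/
def mean (P : Measure Ω) (X Y : Ω → ℝ) (A : Set (ℝ × ℝ)) (Z : Ω → ℝ) : ℝ :=
  ∫ ω, Z ω ∂(P[|{ω | (X ω, Y ω) ∈ A}])

/-- The conditional variance `σ²_A(Z) = E[(Z - μ_A(Z))² | (X, Y) ∈ A]`. -/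
def variance (P : Measure Ω) (X Y : Ω → ℝ) (A : Set (ℝ × ℝ)) (Z : Ω → ℝ) : ℝ :=
  mean P X Y A (fun ω => (Z ω - mean P X Y A Z) ^ 2)

/-- The conditional covariance
`Cov_A(X, Y) = E[(X - μ_A(X)) (Y - μ_A(Y)) | (X, Y) ∈ A]`. -/
def covariance (P : Measure Ω) (X Y : Ω → ℝ) (A : Set (ℝ × ℝ)) : ℝ :=
  mean P X Y A (fun ω => (X ω - mean P X Y A X) * (Y ω - mean P X Y A Y))

/-- The conditional correlation `Cor_A(X, Y)`. -/
def correlation (P : Measure Ω) (X Y : Ω → ℝ) (A : Set (ℝ × ℝ)) : ℝ :=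
  covariance P X Y A / Real.sqrt (variance P X Y A X * variance P X Y A Y)

end Population

/-! Sample quantities, for a bivariate sample `(x i, y i)` of size `n` and a fixed set `A`.
Division by zero gives zero, which is the convention for samples without points in `A`. -/

section Sample

variable {n : ℕ}

/-- The number of sample points in `A`. -/
def sampleCount (x y : Fin n → ℝ) (A : Set (ℝ × ℝ)) : ℝ :=
  ∑ i, A.indicator (fun _ => (1 : ℝ)) (x i, y i)

/-- The sample conditional mean of `z`, over the indices `i` with `(x i, y i) ∈ A`. -/
def sampleMean (x y : Fin n → ℝ) (A : Set (ℝ × ℝ)) (z : Fin n → ℝ) : ℝ :=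
  (1 / sampleCount x y A) * ∑ i, z i * A.indicator (fun _ => (1 : ℝ)) (x i, y i)

/-- The sample conditional variance of `z`. -/
def sampleVariance (x y : Fin n → ℝ) (A : Set (ℝ × ℝ)) (z : Fin n → ℝ) : ℝ :=
  sampleMean x y A (fun i => (z i - sampleMean x y A z) ^ 2)

/-- The sample conditional covariance of `x` and `y`. -/
def sampleCovariance (x y : Fin n → ℝ) (A : Set (ℝ × ℝ)) : ℝ :=
  sampleMean x y A (fun i => (x i - sampleMean x y A x) * (y i - sampleMean x y A y))

/-- The sample conditional correlation of `x` and `y`, with known set `A`. -/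
def sampleCorrelation (x y : Fin n → ℝ) (A : Set (ℝ × ℝ)) : ℝ :=
  sampleCovariance x y A / Real.sqrt (sampleVariance x y A x * sampleVariance x y A y)

end Sample

/-! Time series. -/

/-- `Q` is the inverse, on `(0, 1)`, of the distribution function `F`: for every `u ∈ (0, 1)` the
equation `F x = u` has the unique solution `x = Q u`. -/
def IsInverseCDF (F Q : ℝ → ℝ) : Prop :=
  ∀ u ∈ Ioo (0 : ℝ) 1, ∀ x : ℝ, F x = u ↔ x = Q u

/-- The quantile square `[Q(p), Q(q)] × [Q(p), Q(q)]`. -/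
def quantileSquare (Q : ℝ → ℝ) (p q : ℝ) : Set (ℝ × ℝ) :=
  Icc (Q p) (Q q) ×ˢ Icc (Q p) (Q q)

/-- The lag `h` conditional autocorrelation `ρ_A(h) = Cor_A(X_t, X_{t+h})`, computed at time `t`. -/
def autocorr {Ω : Type*} [MeasurableSpace Ω] (P : Measure Ω) (X : ℤ → Ω → ℝ)
    (A : Set (ℝ × ℝ)) (t : ℤ) (h : ℕ) : ℝ :=
  correlation P (X t) (X (t + (h : ℤ))) A

/-- The lag `h` conditional autocorrelation estimator with known `A`: the sample conditional
correlation of `(X_t)`, `t = 1, …, n`, and `(X_t)`, `t = 1 + h, …, n + h`. -/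
def autocorrEstimator {Ω : Type*} (X : ℤ → Ω → ℝ) (A : Set (ℝ × ℝ)) (h n : ℕ) (ω : Ω) : ℝ :=
  sampleCorrelation (n := n) (fun i => X (((i : ℕ) : ℤ) + 1) ω)
    (fun i => X (((i : ℕ) : ℤ) + 1 + (h : ℤ)) ω) A

end CondCorr

end

open scoped Topology

/-! Let `S = [Q p, Q q]`, let `w` be its indicator, `c` the mean of `w(X_t)`, and `m` the mean of
`X_t` given `X_t ∈ S`. Since the conditioning set is a square, its indicator is `w(x) w(y)`, so
independence survives the conditioning and the population autocorrelation is zero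
(`correlation_eq_zero_of_indepFun`). It remains to find the limit of `√n` times the estimator.

Put `f(x) = (x - m) w(x)`, a bounded centered function with second moment `v > 0`
(`integral_sq_indicator_pos`); its boundedness is why no moments are needed. Sample covariances do
not change under a shift by `m`, so `√n` times the estimator is `n^(-1/2) ∑ f(Y_i) f(Y_{i+h})`
divided by a normalized root of variances, plus a term from the estimated means
(`autocorrEstimator_eq`). The root tends in probability to `v c`. The extra term is `√n` times a
product of two averages of order `n^(-1/2)`, up to factors that converge, so it vanishes.

The main sum has `h`-dependent but orthogonal terms. Its central limit theorem follows McLeish's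
argument: the product `∏ (1 + i d_j)` over scaled terms `d_j` has mean one and equals `exp(i ∑ d_j)
exp(∑ d_j² / 2)` up to a cubic error, while `∑ d_j²` concentrates by an `L²` weak law. The
characteristic function is thereby Gaussian in the limit, with variance `v²`. Slutsky's theorem
gives `τ = v² / (v c)² = 1 / c²`. -/

namespace CondCorr

/-! ### Orthogonality of centered factors, and second moments of orthogonal sums. -/

section Independence

variable {Ω : Type*} [MeasurableSpace Ω] {P : Measure Ω} {Y : ℕ → Ω → ℝ}

/-- In an independent sequence, one coordinate is independent of the sequence restricted to a
finite set of other indices (and extended by zero). -/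
lemma indepFun_restrict_finset (hY : iIndepFun Y P) (hm : ∀ i, Measurable (Y i))
    {k : ℕ} {s : Finset ℕ} (hk : k ∉ s) :
    IndepFun (Y k) (fun ω j => if j ∈ s then Y j ω else 0) P := by
  have h := hY.indepFun_finset {k} s (by simpa using hk) hm
  have h1 : Measurable (fun v : ({k} : Finset ℕ) → ℝ => v ⟨k, by simp⟩) := measurable_pi_apply _
  have h2 : Measurable (fun (v : s → ℝ) (j : ℕ) => if hj : j ∈ s then v ⟨j, hj⟩ else 0) := by
    refine measurable_pi_lambda _ fun j => ?_
    by_cases hj : j ∈ s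
    · simpa [hj] using measurable_pi_apply _
    · simp [hj]
  have h3 := h.comp h1 h2
  have e : (fun ω j => if j ∈ s then Y j ω else 0) =
      (fun (v : s → ℝ) (j : ℕ) => if hj : j ∈ s then v ⟨j, hj⟩ else 0) ∘ fun ω (i : s) => Y i ω := by
    ext ω j; simp
  rw [e]
  exact h3

/-- A centered function of one coordinate of an independent sequence is orthogonal to every
function of finitely many other coordinates. -/
lemma integral_centered_smul_eq_zero {E : Type*} [NormedAddCommGroup E] [NormedSpace ℝ E]
    [MeasurableSpace E] [BorelSpace E] [SecondCountableTopology E]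
    (hY : iIndepFun Y P) (hm : ∀ i, Measurable (Y i))
    {k : ℕ} {s : Finset ℕ} (hk : k ∉ s) {f : ℝ → ℝ} (hf : Measurable f)
    (hf0 : ∫ ω, f (Y k ω) ∂P = 0) {F : (ℕ → ℝ) → E} (hF : Measurable F)
    (hFs : ∀ y, F (fun j => if j ∈ s then y j else 0) = F y) :
    ∫ ω, f (Y k ω) • F (fun j => Y j ω) ∂P = 0 := by
  have h := (indepFun_restrict_finset hY hm hk).comp hf hF
  have h1 : Measurable (fun ω (j : ℕ) => if j ∈ s then Y j ω else 0) := by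
    refine measurable_pi_lambda _ fun j => ?_
    by_cases hj : j ∈ s
    · simpa [hj] using hm j
    · simp [hj]
  have h2 := h.integral_fun_smul_eq_smul_integral (hf.comp (hm k)).aestronglyMeasurable
    (hF.comp h1).aestronglyMeasurable
  simp only [Function.comp_def, hf0, zero_smul] at h2
  rw [← h2]
  simp only [hFs (fun j => Y j _)]

end Independence

section SecondMoment

variable {Ω : Type*} [MeasurableSpace Ω] {P : Measure Ω} [IsProbabilityMeasure P]

/-- The second moment of a sum of orthogonal bounded variables grows at most linearly. -/
lemma integral_sum_sq_le {Z : ℕ → Ω → ℝ} (hm : ∀ i, Measurable (Z i)) {K : ℝ}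
    (hK : ∀ i ω, |Z i ω| ≤ K) (h0 : ∀ i j, i < j → ∫ ω, Z i ω * Z j ω ∂P = 0) (n : ℕ) :
    ∫ ω, (∑ i ∈ Finset.range n, Z i ω) ^ 2 ∂P ≤ n * K ^ 2 := by
  have hint : ∀ i j, Integrable (fun ω => Z i ω * Z j ω) P := fun i j => by
    refine Integrable.of_bound ((hm i).mul (hm j)).aestronglyMeasurable (K * K)
      (ae_of_all _ fun ω => ?_)
    rw [norm_mul]
    exact mul_le_mul (hK i ω) (hK j ω) (abs_nonneg _) ((abs_nonneg _).trans (hK i ω))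
  induction n with
  | zero => simp
  | succ n ih =>
    have hcross : ∫ ω, (∑ i ∈ Finset.range n, Z i ω) * Z n ω ∂P = 0 := by
      simp_rw [Finset.sum_mul]
      rw [integral_finsetSum _ fun i _ => hint i n]
      exact Finset.sum_eq_zero fun i hi => h0 i n (Finset.mem_range.1 hi)
    have hi1 : Integrable (fun ω => (∑ i ∈ Finset.range n, Z i ω) ^ 2) P := by
      simp_rw [sq, Finset.sum_mul_sum]
      exact integrable_finsetSum _ fun i _ => integrable_finsetSum _ fun j _ => hint i j
    have hi2 : Integrable (fun ω => (∑ i ∈ Finset.range n, Z i ω) * Z n ω) P := by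
      simp_rw [Finset.sum_mul]
      exact integrable_finsetSum _ fun i _ => hint i n
    have hlast : ∫ ω, Z n ω * Z n ω ∂P ≤ K ^ 2 := by
      calc ∫ ω, Z n ω * Z n ω ∂P ≤ ∫ _, K ^ 2 ∂P := by
            refine integral_mono (hint n n) (integrable_const _) fun ω => ?_
            have := sq_le_sq' (neg_le_of_abs_le (hK n ω)) (le_of_abs_le (hK n ω))
            simpa [sq] using this
        _ = K ^ 2 := by simp
    calc ∫ ω, (∑ i ∈ Finset.range (n + 1), Z i ω) ^ 2 ∂P
        = ∫ ω, ((∑ i ∈ Finset.range n, Z i ω) ^ 2 + 2 * ((∑ i ∈ Finset.range n, Z i ω) * Z n ω))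
            + Z n ω * Z n ω ∂P := by
          congr 1; ext ω; rw [Finset.sum_range_succ]; ring
      _ = ∫ ω, (∑ i ∈ Finset.range n, Z i ω) ^ 2 ∂P + ∫ ω, Z n ω * Z n ω ∂P := by
          have hi3 : Integrable (fun ω => (∑ i ∈ Finset.range n, Z i ω) ^ 2 +
              2 * ((∑ i ∈ Finset.range n, Z i ω) * Z n ω)) P := hi1.add (hi2.const_mul 2)
          rw [integral_add hi3 (hint n n), integral_add hi1 (hi2.const_mul 2), integral_const_mul,
            hcross]
          ring
      _ ≤ (n + 1 : ℕ) * K ^ 2 := by push_cast; linarith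

end SecondMoment

/-! ### Lag sums and their weak law in `L²`. -/

/-- The sum `∑_{i < n} f(y_i) g(y_{i+h})` of lag `h` products. -/
def lagSum (f g : ℝ → ℝ) (h n : ℕ) (y : ℕ → ℝ) : ℝ :=
  ∑ i ∈ Finset.range n, f (y i) * g (y (i + h))

lemma measurable_lagSum {f g : ℝ → ℝ} (hf : Measurable f) (hg : Measurable g) (h n : ℕ) :
    Measurable (lagSum f g h n) := by
  unfold lagSum; fun_prop

lemma abs_lagSum_le {f g : ℝ → ℝ} {K L : ℝ} (hfK : ∀ x, |f x| ≤ K) (hgL : ∀ x, |g x| ≤ L)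
    (h n : ℕ) (y : ℕ → ℝ) : |lagSum f g h n y| ≤ n * (K * L) := by
  have h1 : ∀ i ∈ Finset.range n, |f (y i) * g (y (i + h))| ≤ K * L := fun i _ => by
    rw [abs_mul]
    exact mul_le_mul (hfK _) (hgL _) (abs_nonneg _) ((abs_nonneg _).trans (hfK 0))
  calc |lagSum f g h n y| ≤ ∑ i ∈ Finset.range n, |f (y i) * g (y (i + h))| :=
        Finset.abs_sum_le_sum_abs _ _
    _ ≤ n * (K * L) := by simpa using Finset.sum_le_sum h1

section Lag

variable {Ω : Type*} [MeasurableSpace Ω] {P : Measure Ω} [IsProbabilityMeasure P]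
  {Y : ℕ → Ω → ℝ} {f g : ℝ → ℝ} {K L : ℝ} {h : ℕ}

/-- For `i < j` the smallest index `i` occurs only in the centered factor `f(Y_i)`, because `h ≥ 1`.
Hence distinct terms are orthogonal, even when `i + h = j`. -/
lemma integral_lagSum_sq_le_of_left (hY : iIndepFun Y P) (hm : ∀ i, Measurable (Y i))
    (hf : Measurable f) (hg : Measurable g) (hfK : ∀ x, |f x| ≤ K) (hgL : ∀ x, |g x| ≤ L)
    (hh : 1 ≤ h) (hf0 : ∀ i, ∫ ω, f (Y i ω) ∂P = 0) (n : ℕ) :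
    ∫ ω, (lagSum f g h n fun i => Y i ω) ^ 2 ∂P ≤ n * (K * L) ^ 2 := by
  refine integral_sum_sq_le (Z := fun i ω => f (Y i ω) * g (Y (i + h) ω)) (fun i => ?_)
    (fun i ω => ?_) (fun i j hij => ?_) n
  · exact (hf.comp (hm _)).mul (hg.comp (hm _))
  · rw [abs_mul]
    exact mul_le_mul (hfK _) (hgL _) (abs_nonneg _) ((abs_nonneg _).trans (hfK 0))
  · have := integral_centered_smul_eq_zero hY hm (k := i) (s := {i + h, j, j + h})
      (by simp; omega) hf (hf0 i)
      (F := fun y => g (y (i + h)) * (f (y j) * g (y (j + h)))) (by fun_prop) (by simp)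
    simpa [mul_assoc] using this

/-- Mirror image of the left version: for `i < j` it is now the largest index `j + h` that occurs
only once, in a centered factor. -/
lemma integral_lagSum_sq_le_of_right (hY : iIndepFun Y P) (hm : ∀ i, Measurable (Y i))
    (hf : Measurable f) (hg : Measurable g) (hfK : ∀ x, |f x| ≤ K) (hgL : ∀ x, |g x| ≤ L)
    (hh : 1 ≤ h) (hg0 : ∀ i, ∫ ω, g (Y i ω) ∂P = 0) (n : ℕ) :
    ∫ ω, (lagSum f g h n fun i => Y i ω) ^ 2 ∂P ≤ n * (K * L) ^ 2 := by
  refine integral_sum_sq_le (Z := fun i ω => f (Y i ω) * g (Y (i + h) ω)) (fun i => ?_)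
    (fun i ω => ?_) (fun i j hij => ?_) n
  · exact (hf.comp (hm _)).mul (hg.comp (hm _))
  · rw [abs_mul]
    exact mul_le_mul (hfK _) (hgL _) (abs_nonneg _) ((abs_nonneg _).trans (hfK 0))
  · have := integral_centered_smul_eq_zero hY hm (k := j + h) (s := {i, i + h, j})
      (by simp; omega) hg (hg0 (j + h))
      (F := fun y => f (y i) * g (y (i + h)) * f (y j)) (by fun_prop) (by simp)
    rw [← this]
    congr 1; ext ω; simp only [smul_eq_mul]; ring

/-- Quantitative weak law of large numbers for lag products, in `L²`. -/
lemma exists_integral_lagSum_sub_sq_le (hY : iIndepFun Y P) (hm : ∀ i, Measurable (Y i))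
    (hf : Measurable f) (hg : Measurable g) (hfK : ∀ x, |f x| ≤ K) (hgL : ∀ x, |g x| ≤ L)
    (hh : 1 ≤ h) {a b : ℝ} (hfa : ∀ i, ∫ ω, f (Y i ω) ∂P = a)
    (hgb : ∀ i, ∫ ω, g (Y i ω) ∂P = b) :
    ∃ C, 0 ≤ C ∧ ∀ n : ℕ, ∫ ω, (lagSum f g h n (fun i => Y i ω) - n * (a * b)) ^ 2 ∂P ≤ C * n := by
  have hint : ∀ (u : ℝ → ℝ) (M : ℝ), Measurable u → (∀ x, |u x| ≤ M) → ∀ i,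
      Integrable (fun ω => u (Y i ω)) P := fun u M hu hM i =>
    Integrable.of_bound (hu.comp (hm i)).aestronglyMeasurable M (ae_of_all _ fun ω => hM _)
  have hcenter : ∀ (u : ℝ → ℝ) (M c : ℝ), Measurable u → (∀ x, |u x| ≤ M) →
      (∀ i, ∫ ω, u (Y i ω) ∂P = c) → ∀ i, ∫ ω, (u (Y i ω) - c) ∂P = 0 := fun u M c hu hM hc i => by
    rw [integral_sub (hint u M hu hM i) (integrable_const _), hc]; simp
  have hbd : ∀ (u : ℝ → ℝ) (M c : ℝ), (∀ x, |u x| ≤ M) → ∀ x, |u x - c| ≤ M + |c| :=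
    fun u M c hM x => (abs_sub _ _).trans (by gcongr; exact hM x)
  -- The splitting `f g - a b = (f - a) g + a (g - b)` leaves one centered factor in each piece.
  have h1 := integral_lagSum_sq_le_of_left (f := fun x => f x - a) hY hm (hf.sub_const a) hg
    (hbd f K a hfK) hgL hh (hcenter f K a hf hfK hfa)
  have h2 := integral_lagSum_sq_le_of_right (f := fun _ => a) (g := fun x => g x - b) hY hm
    measurable_const (hg.sub_const b) (fun _ => le_rfl) (hbd g L b hgL) hh (hcenter g L b hg hgL hgb)
  refine ⟨2 * ((K + |a|) * L) ^ 2 + 2 * (|a| * (L + |b|)) ^ 2, by positivity, fun n => ?_⟩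
  set U : Ω → ℝ := fun ω => lagSum (fun x => f x - a) g h n fun i => Y i ω with hU
  set V : Ω → ℝ := fun ω => lagSum (fun _ => a) (fun x => g x - b) h n fun i => Y i ω with hV
  have hmY : Measurable fun ω i => Y i ω := measurable_pi_lambda _ hm
  have hUm : Measurable U := (measurable_lagSum (hf.sub_const a) hg h n).comp hmY
  have hVm : Measurable V := (measurable_lagSum measurable_const (hg.sub_const b) h n).comp hmY
  have hsq : ∀ {W : Ω → ℝ} {M : ℝ}, Measurable W → (∀ ω, |W ω| ≤ M) →
      Integrable (fun ω => W ω ^ 2) P := fun {W M} hW hM => by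
    refine Integrable.of_bound (hW.pow_const 2).aestronglyMeasurable (M ^ 2) (ae_of_all _ fun ω => ?_)
    rw [norm_pow]
    exact pow_le_pow_left₀ (norm_nonneg _) (hM ω) 2
  have hUi : Integrable (fun ω => U ω ^ 2) P :=
    hsq hUm fun ω => abs_lagSum_le (hbd f K a hfK) hgL h n _
  have hVi : Integrable (fun ω => V ω ^ 2) P :=
    hsq hVm fun ω => abs_lagSum_le (fun _ => le_rfl) (hbd g L b hgL) h n _
  have hUV : ∀ ω, lagSum f g h n (fun i => Y i ω) - n * (a * b) = U ω + V ω := fun ω => by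
    have : (n : ℝ) * (a * b) = ∑ i ∈ Finset.range n, a * b := by simp
    simp only [hU, hV, lagSum, this, ← Finset.sum_sub_distrib, ← Finset.sum_add_distrib]
    exact Finset.sum_congr rfl fun i _ => by ring
  calc ∫ ω, (lagSum f g h n (fun i => Y i ω) - n * (a * b)) ^ 2 ∂P
      ≤ ∫ ω, 2 * U ω ^ 2 + 2 * V ω ^ 2 ∂P := by
        refine integral_mono_of_nonneg (ae_of_all _ fun ω => sq_nonneg _)
          ((hUi.const_mul 2).add (hVi.const_mul 2)) (ae_of_all _ fun ω => ?_)
        simp only [hUV]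
        nlinarith [sq_nonneg (U ω - V ω)]
    _ = 2 * ∫ ω, U ω ^ 2 ∂P + 2 * ∫ ω, V ω ^ 2 ∂P := by
        rw [integral_add (hUi.const_mul 2) (hVi.const_mul 2), integral_const_mul,
          integral_const_mul]
    _ ≤ _ := by linarith [h1 n, h2 n]

end Lag

/-! ### Expansion of `∏ (1 + i d_j)`. -/

section ComplexEstimates

lemma norm_log_one_add_mul_I_sub_le {x : ℝ} (hx : |x| ≤ 1 / 2) :
    ‖Complex.log (1 + x * Complex.I) - (x * Complex.I + x ^ 2 / 2)‖ ≤ |x| ^ 3 := by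
  have hn : ‖(x * Complex.I : ℂ)‖ = |x| := by simp
  have h := Complex.norm_log_sub_logTaylor_le 2 (z := x * Complex.I) (by rw [hn]; linarith)
  have ht : Complex.logTaylor (2 + 1) (x * Complex.I) = x * Complex.I + x ^ 2 / 2 := by
    simp [Complex.logTaylor, Finset.sum_range_succ, mul_pow]
    ring
  rw [ht, hn] at h
  refine h.trans ?_
  have h2 : (1 - |x|)⁻¹ ≤ 2 := by
    rw [inv_le_comm₀ (by linarith) two_pos]; linarith
  have h3 : 0 ≤ |x| ^ 3 := by positivity
  rw [div_le_iff₀ (by norm_num)]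
  norm_num
  nlinarith

/-- Mean value inequality on a half-plane, which is convex and on which the derivative of `exp` is
at most `exp M` in norm. -/
lemma norm_exp_sub_exp_le {a b : ℂ} {M : ℝ} (ha : a.re ≤ M) (hb : b.re ≤ M) :
    ‖Complex.exp a - Complex.exp b‖ ≤ Real.exp M * ‖a - b‖ := by
  refine Convex.norm_image_sub_le_of_norm_deriv_le (𝕜 := ℂ) (s := {z : ℂ | z.re ≤ M})
    (fun z _ => Complex.differentiableAt_exp) (fun z hz => ?_) (convex_halfSpace_re_le M) hb ha
  rw [Complex.deriv_exp, Complex.norm_exp]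
  exact Real.exp_le_exp.2 hz

/-- A product `∏ (1 + i d_j)` with small real `d_j` is the exponential of `i ∑ d_j + ∑ d_j² / 2`,
up to a cubic error in the exponent. -/
lemma exists_prod_one_add_mul_I_eq_exp {n : ℕ} {d : ℕ → ℝ} {δ : ℝ}
    (hδ : δ ≤ 1 / 2) (hd : ∀ i, |d i| ≤ δ) :
    ∃ W : ℂ, ‖W‖ ≤ n * δ ^ 3 ∧
      ∏ i ∈ Finset.range n, (1 + d i * Complex.I) =
        Complex.exp ((∑ i ∈ Finset.range n, d i : ℝ) * Complex.I) *
          Complex.exp ((∑ i ∈ Finset.range n, d i ^ 2 : ℝ) / 2 + W) := by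
  refine ⟨∑ i ∈ Finset.range n,
    (Complex.log (1 + d i * Complex.I) - (d i * Complex.I + d i ^ 2 / 2)), ?_, ?_⟩
  · refine (norm_sum_le _ _).trans ?_
    have : ∀ i ∈ Finset.range n,
        ‖Complex.log (1 + d i * Complex.I) - (d i * Complex.I + d i ^ 2 / 2)‖ ≤ δ ^ 3 :=
      fun i _ => (norm_log_one_add_mul_I_sub_le ((hd i).trans hδ)).trans
        (pow_le_pow_left₀ (abs_nonneg _) (hd i) 3)
    simpa using Finset.sum_le_sum this
  · have hne : ∀ i, (1 + d i * Complex.I : ℂ) ≠ 0 := fun i h0 => by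
      have := congrArg Complex.re h0
      simp at this
    rw [← Complex.exp_add]
    have : ((∑ i ∈ Finset.range n, d i : ℝ) * Complex.I +
        ((∑ i ∈ Finset.range n, d i ^ 2 : ℝ) / 2 + ∑ i ∈ Finset.range n,
          (Complex.log (1 + d i * Complex.I) - (d i * Complex.I + d i ^ 2 / 2))) : ℂ) =
        ∑ i ∈ Finset.range n, Complex.log (1 + d i * Complex.I) := by
      push_cast
      rw [Finset.sum_mul, Finset.sum_div, ← Finset.sum_add_distrib, ← Finset.sum_add_distrib]
      exact Finset.sum_congr rfl fun i _ => by ring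
    rw [this, Complex.exp_sum]
    exact Finset.prod_congr rfl fun i _ => (Complex.exp_log (hne i)).symm

end ComplexEstimates

/-! ### Central limit theorem for lag sums by characteristic functions. -/

section CentralLimit

variable {Ω : Type*} [MeasurableSpace Ω] {P : Measure Ω} [IsProbabilityMeasure P]
  {Y : ℕ → Ω → ℝ} {f : ℝ → ℝ} {K v : ℝ} {h : ℕ}

/-- The complex martingale `∏ (1 + i c f(Y_j) f(Y_{j+h}))` has mean one. -/
lemma integral_prod_one_add_mul_I (hY : iIndepFun Y P) (hm : ∀ i, Measurable (Y i))
    (hf : Measurable f) (hfK : ∀ x, |f x| ≤ K) (hh : 1 ≤ h)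
    (hf0 : ∀ i, ∫ ω, f (Y i ω) ∂P = 0) (c : ℝ) (n : ℕ) :
    ∫ ω, ∏ i ∈ Finset.range n,
      (1 + (c * (f (Y i ω) * f (Y (i + h) ω)) : ℝ) * Complex.I) ∂P = 1 := by
  have hbd : ∀ (n : ℕ) (ω : Ω), ‖∏ i ∈ Finset.range n,
      (1 + (c * (f (Y i ω) * f (Y (i + h) ω)) : ℝ) * Complex.I)‖ ≤ (1 + |c| * (K * K)) ^ n := by
    intro n ω
    rw [norm_prod]
    have : ∀ i ∈ Finset.range n, ‖(1 + (c * (f (Y i ω) * f (Y (i + h) ω)) : ℝ) * Complex.I)‖ ≤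
        1 + |c| * (K * K) := fun i _ => by
      refine (norm_add_le _ _).trans ?_
      rw [norm_one, norm_mul, Complex.norm_I, mul_one, Complex.norm_real, Real.norm_eq_abs,
        abs_mul, abs_mul]
      gcongr
      · exact (abs_nonneg _).trans (hfK 0)
      · exact hfK _
      · exact hfK _
    simpa using Finset.prod_le_prod (fun i _ => norm_nonneg _) this
  induction n with
  | zero => simp
  | succ n ih =>
    -- The new factor adds `f(Y_{n+h})` times `F`. As `h ≥ 1`, `F` involves only indices below `n +
    -- h`, so the increment has mean zero.
    set F : (ℕ → ℝ) → ℂ := fun y => (∏ i ∈ Finset.range n,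
      (1 + (c * (f (y i) * f (y (i + h))) : ℝ) * Complex.I)) * ((c * f (y n) : ℝ) * Complex.I)
      with hF
    have hFm : Measurable F := by
      simp only [hF]
      fun_prop
    have hz := integral_centered_smul_eq_zero hY hm (k := n + h) (s := Finset.range (n + h))
      (by simp) hf (hf0 (n + h)) hFm (fun y => by
        simp only [hF]
        have hn : n ∈ Finset.range (n + h) := by simp; omega
        rw [if_pos hn]
        congr 1
        refine Finset.prod_congr rfl fun i hi => ?_
        have hi' := Finset.mem_range.1 hi
        rw [if_pos (by simp; omega), if_pos (by simp; omega)])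
    have h1 : Integrable (fun ω => ∏ i ∈ Finset.range n,
        (1 + (c * (f (Y i ω) * f (Y (i + h) ω)) : ℝ) * Complex.I)) P := by
      refine Integrable.of_bound (Measurable.aestronglyMeasurable ?_) _ (ae_of_all _ (hbd n))
      fun_prop
    have hsplit : ∀ ω, ∏ i ∈ Finset.range (n + 1),
        (1 + (c * (f (Y i ω) * f (Y (i + h) ω)) : ℝ) * Complex.I) =
        ∏ i ∈ Finset.range n, (1 + (c * (f (Y i ω) * f (Y (i + h) ω)) : ℝ) * Complex.I) +
          f (Y (n + h) ω) • F (fun j => Y j ω) := fun ω => by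
      rw [Finset.prod_range_succ, hF, Complex.real_smul]
      push_cast
      ring
    have h2 : Integrable (fun ω => f (Y (n + h) ω) • F (fun j => Y j ω)) P := by
      have h3 : Integrable (fun ω => ∏ i ∈ Finset.range (n + 1),
          (1 + (c * (f (Y i ω) * f (Y (i + h) ω)) : ℝ) * Complex.I)) P := by
        refine Integrable.of_bound (Measurable.aestronglyMeasurable ?_) _ (ae_of_all _ (hbd _))
        fun_prop
      refine (h3.sub h1).congr (ae_of_all _ fun ω => ?_)
      simp only [Pi.sub_apply, hsplit, add_sub_cancel_left]
    simp_rw [hsplit]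
    rw [integral_add h1 h2, ih, hz, add_zero]

/-- The `L¹` bound comes from the `L²` bound `C n` through `|x| ≤ x² / (2√n) + √n / 2`; the weight
`√n` makes both terms of order `√n`. -/
lemma integral_abs_lagSum_sub_le (hY : iIndepFun Y P) (hm : ∀ i, Measurable (Y i))
    (hf : Measurable f) (hfK : ∀ x, |f x| ≤ K) (hh : 1 ≤ h)
    (hv : ∀ i, ∫ ω, f (Y i ω) ∂P = v) :
    ∃ C, 0 ≤ C ∧ ∀ n : ℕ, 0 < n →
      ∫ ω, |lagSum f f h n (fun i => Y i ω) - n * (v * v)| ∂P ≤ C * √n := by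
  obtain ⟨C, hC, hCn⟩ := exists_integral_lagSum_sub_sq_le hY hm hf hf hfK hfK hh hv hv
  refine ⟨(C + 1) / 2, by positivity, fun n hn => ?_⟩
  have hs : 0 < √(n : ℝ) := Real.sqrt_pos.2 (by exact_mod_cast hn)
  have hss : √(n : ℝ) * √n = n := Real.mul_self_sqrt (Nat.cast_nonneg n)
  have hmY : Measurable fun ω i => Y i ω := measurable_pi_lambda _ hm
  have hi : Integrable (fun ω => (lagSum f f h n (fun i => Y i ω) - n * (v * v)) ^ 2) P := by
    refine Integrable.of_bound ((((measurable_lagSum hf hf h n).comp hmY).sub_const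
      _).pow_const 2).aestronglyMeasurable ((n * (K * K) + |n * (v * v)|) ^ 2)
      (ae_of_all _ fun ω => ?_)
    rw [norm_pow]
    refine pow_le_pow_left₀ (norm_nonneg _) ((norm_sub_le _ _).trans ?_) 2
    exact add_le_add (abs_lagSum_le hfK hfK h n _) le_rfl
  calc ∫ ω, |lagSum f f h n (fun i => Y i ω) - n * (v * v)| ∂P
      ≤ ∫ ω, (2 * √n)⁻¹ * (lagSum f f h n (fun i => Y i ω) - n * (v * v)) ^ 2 + √n / 2 ∂P := by
        refine integral_mono_of_nonneg (ae_of_all _ fun ω => abs_nonneg _)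
          ((hi.const_mul _).add (integrable_const _)) (ae_of_all _ fun ω => ?_)
        simp only
        set x := lagSum f f h n (fun i => Y i ω) - n * (v * v)
        have : 0 ≤ (2 * √(n : ℝ))⁻¹ * (|x| - √n) ^ 2 := by positivity
        have e : (2 * √(n : ℝ))⁻¹ * (|x| - √n) ^ 2 = (2 * √(n : ℝ))⁻¹ * x ^ 2 + √n / 2 - |x| := by
          rw [sub_sq, sq_abs]
          field_simp
          ring
        linarith
    _ = (2 * √n)⁻¹ * ∫ ω, (lagSum f f h n (fun i => Y i ω) - n * (v * v)) ^ 2 ∂P + √n / 2 := by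
        rw [integral_add (hi.const_mul _) (integrable_const _), integral_const_mul]; simp
    _ ≤ (2 * √n)⁻¹ * (C * n) + √n / 2 := by gcongr; exact hCn n
    _ = (C + 1) / 2 * √n := by
        nth_rw 2 [← hss]; field_simp

/-- The `1` is the mean of the product `∏ (1 + i d_j)`, which equals the oscillating exponential
times `exp(Q / 2 + W)`, with `Q = ∑ d_j²` and `W` the cubic error. The oscillating factor has
modulus one, so only `exp(V / 2) - exp(Q / 2 + W)` has to be estimated. -/
lemma norm_exp_mul_integral_exp_sub_one_le (hY : iIndepFun Y P) (hm : ∀ i, Measurable (Y i))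
    (hf : Measurable f) (hfK : ∀ x, |f x| ≤ K) (hh : 1 ≤ h)
    (hf0 : ∀ i, ∫ ω, f (Y i ω) ∂P = 0) (c V : ℝ) (n : ℕ) (hc : |c| * (K * K) ≤ 1 / 2) :
    ‖Complex.exp (V / 2 : ℝ) * ∫ ω, Complex.exp ((c * lagSum f f h n (fun i => Y i ω) : ℝ)
        * Complex.I) ∂P - 1‖ ≤
      Real.exp (|V| / 2 + n * (|c| * (K * K)) ^ 2) *
        ((∫ ω, |c ^ 2 * lagSum (fun x => f x ^ 2) (fun x => f x ^ 2) h n (fun i => Y i ω) - V| ∂P) / 2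
          + n * (|c| * (K * K)) ^ 3) := by
  set δ := |c| * (K * K) with hδdef
  have hδ0 : 0 ≤ δ := mul_nonneg (abs_nonneg c) (mul_self_nonneg K)
  set d : Ω → ℕ → ℝ := fun ω i => c * (f (Y i ω) * f (Y (i + h) ω)) with hd
  have hdδ : ∀ ω i, |d ω i| ≤ δ := fun ω i => by
    simp only [hd, abs_mul, hδdef]
    gcongr
    · exact (abs_nonneg _).trans (hfK 0)
    · exact hfK _
    · exact hfK _
  have hsum : ∀ ω, ∑ i ∈ Finset.range n, d ω i = c * lagSum f f h n (fun i => Y i ω) := fun ω => by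
    simp only [hd, lagSum, Finset.mul_sum]
  have hsq : ∀ ω, ∑ i ∈ Finset.range n, d ω i ^ 2 =
      c ^ 2 * lagSum (fun x => f x ^ 2) (fun x => f x ^ 2) h n (fun i => Y i ω) := fun ω => by
    simp only [hd, lagSum, Finset.mul_sum, mul_pow]
  set E : Ω → ℂ := fun ω =>
    Complex.exp ((c * lagSum f f h n (fun i => Y i ω) : ℝ) * Complex.I) with hE
  set Q : Ω → ℝ := fun ω =>
    c ^ 2 * lagSum (fun x => f x ^ 2) (fun x => f x ^ 2) h n (fun i => Y i ω) with hQ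
  have hmY : Measurable fun ω i => Y i ω := measurable_pi_lambda _ hm
  have hlm : Measurable fun ω => lagSum f f h n (fun i => Y i ω) :=
    (measurable_lagSum hf hf h n).comp hmY
  have hQm : Measurable Q :=
    ((measurable_lagSum (hf.pow_const 2) (hf.pow_const 2) h n).comp hmY).const_mul _
  have hQb : ∀ ω, |Q ω| ≤ n * δ ^ 2 := fun ω => by
    rw [hQ]; simp only; rw [← hsq]
    refine (Finset.abs_sum_le_sum_abs _ _).trans ?_
    have : ∀ i ∈ Finset.range n, |d ω i ^ 2| ≤ δ ^ 2 := fun i _ => by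
      rw [abs_pow]; exact pow_le_pow_left₀ (abs_nonneg _) (hdδ ω i) 2
    simpa using Finset.sum_le_sum this
  have hEn : ∀ ω, ‖E ω‖ = 1 := fun ω => Complex.norm_exp_ofReal_mul_I _
  have hEi : Integrable E P := Integrable.of_bound
    (Measurable.aestronglyMeasurable (by simp only [hE]; fun_prop)) 1
    (ae_of_all _ fun ω => (hEn ω).le)
  have hprod := integral_prod_one_add_mul_I hY hm hf hfK hh hf0 c n
  have hpi : Integrable (fun ω => ∏ i ∈ Finset.range n, (1 + (d ω i : ℂ) * Complex.I)) P := by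
    -- A non-integrable function has integral `0` by convention, so mean one forces integrability.
    by_contra hni
    rw [integral_undef hni] at hprod
    exact zero_ne_one hprod
  have hpt : ∀ ω, ‖Complex.exp (V / 2 : ℝ) * E ω -
      ∏ i ∈ Finset.range n, (1 + (d ω i : ℂ) * Complex.I)‖ ≤
      Real.exp (|V| / 2 + n * δ ^ 2) * (|Q ω - V| / 2 + n * δ ^ 3) := fun ω => by
    obtain ⟨W, hW, he⟩ := exists_prod_one_add_mul_I_eq_exp (n := n) hc (hdδ ω)
    rw [he, hsum, hsq, mul_comm, ← mul_sub, norm_mul]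
    have hE1 := hEn ω
    simp only [hE] at hE1
    rw [hE1, one_mul]
    -- From `δ ≤ 1 / 2`. Thus `Q / 2` and `W` each contribute at most `n δ² / 2` to the real part of
    -- the exponent.
    have hδ3 : (n : ℝ) * δ ^ 3 ≤ n * δ ^ 2 / 2 := by
      have : (n : ℝ) * δ ^ 3 = n * δ ^ 2 * δ := by ring
      rw [this, div_eq_mul_one_div]
      gcongr
    have hn2 : 0 ≤ (n : ℝ) * δ ^ 2 := by positivity
    have hre : ((Q ω : ℂ) / 2 + W).re = Q ω / 2 + W.re := by
      rw [Complex.add_re, ← Complex.ofReal_ofNat, ← Complex.ofReal_div, Complex.ofReal_re]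
    have h1 := norm_exp_sub_exp_le (a := ((V / 2 : ℝ) : ℂ)) (b := (Q ω : ℂ) / 2 + W)
      (M := |V| / 2 + n * δ ^ 2) (by rw [Complex.ofReal_re]; linarith [le_abs_self V])
      (by
        rw [hre]
        linarith [le_abs_self (Q ω), hQb ω, Complex.re_le_norm W, abs_nonneg V])
    refine h1.trans ?_
    gcongr
    have h2 : ((V / 2 : ℝ) : ℂ) - ((Q ω : ℂ) / 2 + W) = (((V - Q ω) / 2 : ℝ) : ℂ) - W := by
      push_cast; ring
    rw [h2]
    refine (norm_sub_le _ _).trans ?_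
    rw [Complex.norm_real, Real.norm_eq_abs, abs_div, abs_two, abs_sub_comm]
    gcongr
  have hQi : Integrable (fun ω => |Q ω - V|) P := by
    refine Integrable.abs (Integrable.sub ?_ (integrable_const _))
    exact Integrable.of_bound hQm.aestronglyMeasurable _ (ae_of_all _ hQb)
  have hid : Complex.exp (V / 2 : ℝ) * ∫ ω, E ω ∂P - 1 =
      ∫ ω, (Complex.exp (V / 2 : ℝ) * E ω -
        ∏ i ∈ Finset.range n, (1 + (d ω i : ℂ) * Complex.I)) ∂P := by
    rw [integral_sub (hEi.const_mul _) hpi, integral_const_mul, hprod]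
  rw [hid]
  refine (norm_integral_le_integral_norm _).trans ?_
  calc _ ≤ ∫ ω, Real.exp (|V| / 2 + n * δ ^ 2) * (|Q ω - V| / 2 + n * δ ^ 3) ∂P :=
        integral_mono_of_nonneg (ae_of_all _ fun ω => norm_nonneg _)
          (((hQi.div_const 2).add (integrable_const _)).const_mul _) (ae_of_all _ hpt)
    _ = _ := by
        rw [integral_const_mul, integral_add (hQi.div_const 2) (integrable_const _), integral_div]
        simp [hQ]

/-- The preceding bound is used with `c = t / √n`. Then `n δ² = B²` stays bounded, `n δ³ = B³ / √n`,
and the `L¹` weak law for `f²` bounds the deviation of `∑ d_j²` from `V = t² v²` by a multiple of `1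
/ √n`. -/
lemma tendsto_integral_exp_lagSum (hY : iIndepFun Y P) (hm : ∀ i, Measurable (Y i))
    (hf : Measurable f) (hfK : ∀ x, |f x| ≤ K) (hh : 1 ≤ h)
    (hf0 : ∀ i, ∫ ω, f (Y i ω) ∂P = 0) (hv : ∀ i, ∫ ω, f (Y i ω) ^ 2 ∂P = v) (t : ℝ) :
    Tendsto (fun n : ℕ => ∫ ω, Complex.exp ((t * ((√n)⁻¹ * lagSum f f h n (fun i => Y i ω)) : ℝ)
        * Complex.I) ∂P) atTop (𝓝 (Complex.exp (-(v ^ 2 * t ^ 2 / 2) : ℝ))) := by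
  have hfK2 : ∀ x, |f x ^ 2| ≤ K ^ 2 := fun x => by
    rw [abs_pow]; exact pow_le_pow_left₀ (abs_nonneg _) (hfK x) 2
  obtain ⟨C, hC, hCn⟩ := integral_abs_lagSum_sub_le (f := fun x => f x ^ 2) hY hm (hf.pow_const 2)
    hfK2 hh hv
  have hs : Tendsto (fun n : ℕ => (√(n : ℝ))⁻¹) atTop (𝓝 0) :=
    tendsto_inv_atTop_zero.comp (Real.tendsto_sqrt_atTop.comp tendsto_natCast_atTop_atTop)
  set V := t ^ 2 * v ^ 2 with hV
  set B := |t| * (K * K) with hB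
  have hbound : ∀ᶠ n : ℕ in atTop,
      ‖Complex.exp (V / 2 : ℝ) * ∫ ω, Complex.exp ((t * ((√n)⁻¹ *
        lagSum f f h n (fun i => Y i ω)) : ℝ) * Complex.I) ∂P - 1‖ ≤
      Real.exp (|V| / 2 + B ^ 2) * (t ^ 2 * C / 2 + B ^ 3) * (√n)⁻¹ := by
    have hsB : Tendsto (fun n : ℕ => B * (√(n : ℝ))⁻¹) atTop (𝓝 0) := by
      simpa using hs.const_mul B
    filter_upwards [hsB.eventually (eventually_le_nhds (show (0 : ℝ) < 1 / 2 by norm_num)),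
      eventually_gt_atTop 0] with n hn hn0
    have hsp : 0 < √(n : ℝ) := Real.sqrt_pos.2 (by exact_mod_cast hn0)
    have hss : √(n : ℝ) ^ 2 = n := Real.sq_sqrt (Nat.cast_nonneg n)
    have hδ : |t * (√(n : ℝ))⁻¹| * (K * K) = B * (√(n : ℝ))⁻¹ := by
      rw [abs_mul, abs_of_pos (inv_pos.2 hsp)]; ring
    have h1 := norm_exp_mul_integral_exp_sub_one_le hY hm hf hfK hh hf0 (t * (√(n : ℝ))⁻¹) V n
      (by rw [hδ]; exact hn)
    rw [hδ] at h1
    simp only [← mul_assoc] at h1 ⊢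
    refine h1.trans ?_
    have e2 : (n : ℝ) * (B * (√(n : ℝ))⁻¹) ^ 2 = B ^ 2 := by
      rw [← hss, Real.sqrt_sq hsp.le]; field_simp
    have e3 : (n : ℝ) * (B * (√(n : ℝ))⁻¹) ^ 3 = B ^ 3 * (√(n : ℝ))⁻¹ := by
      rw [← hss, Real.sqrt_sq hsp.le]; field_simp
    have e1 : ∀ ω, |(t * (√(n : ℝ))⁻¹) ^ 2 *
        lagSum (fun x => f x ^ 2) (fun x => f x ^ 2) h n (fun i => Y i ω) - V| =
        t ^ 2 / n * |lagSum (fun x => f x ^ 2) (fun x => f x ^ 2) h n (fun i => Y i ω) -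
          n * (v * v)| := fun ω => by
      have hp : 0 ≤ t ^ 2 / (n : ℝ) := by positivity
      nth_rw 1 [← abs_of_nonneg hp]
      rw [← abs_mul]
      congr 1
      rw [mul_pow, inv_pow, hss, hV]
      field_simp
    simp only [e1]
    rw [integral_const_mul, e2, e3, mul_assoc]
    gcongr
    have := hCn n hn0
    have h4 : t ^ 2 / (n : ℝ) * ∫ ω, |lagSum (fun x => f x ^ 2) (fun x => f x ^ 2) h n
        (fun i => Y i ω) - n * (v * v)| ∂P ≤ t ^ 2 / n * (C * √n) := by gcongr
    have h5 : t ^ 2 / (n : ℝ) * (C * √n) = t ^ 2 * C * (√n)⁻¹ := by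
      rw [← hss, Real.sqrt_sq hsp.le]; field_simp
    rw [h5] at h4
    linarith
  have hlim : Tendsto (fun n : ℕ => Complex.exp (V / 2 : ℝ) * ∫ ω, Complex.exp ((t * ((√n)⁻¹ *
      lagSum f f h n (fun i => Y i ω)) : ℝ) * Complex.I) ∂P) atTop (𝓝 1) := by
    rw [tendsto_iff_norm_sub_tendsto_zero]
    refine squeeze_zero' (Eventually.of_forall fun n => norm_nonneg _) hbound ?_
    simpa using hs.const_mul (Real.exp (|V| / 2 + B ^ 2) * (t ^ 2 * C / 2 + B ^ 3))
  have h2 := hlim.const_mul (Complex.exp (-(V / 2) : ℝ))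
  have e : ∀ z : ℂ, Complex.exp (-(V / 2) : ℝ) * (Complex.exp (V / 2 : ℝ) * z) = z := fun z => by
    rw [← mul_assoc, ← Complex.exp_add]; simp
  simp only [e, mul_one] at h2
  convert h2 using 4
  rw [hV]; ring

/-- Central limit theorem for lag products of a centered bounded function of an independent
sequence. -/
theorem tendstoInDistribution_lagSum (hY : iIndepFun Y P) (hm : ∀ i, Measurable (Y i))
    (hf : Measurable f) (hfK : ∀ x, |f x| ≤ K) (hh : 1 ≤ h)
    (hf0 : ∀ i, ∫ ω, f (Y i ω) ∂P = 0) (hv : ∀ i, ∫ ω, f (Y i ω) ^ 2 ∂P = v)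
    {Ω' : Type*} [MeasurableSpace Ω'] {P' : Measure Ω'} [IsProbabilityMeasure P'] {Z : Ω' → ℝ}
    {s : ℝ≥0} (hs : (s : ℝ) = v ^ 2) (hZ : HasLaw Z (gaussianReal 0 s) P') :
    TendstoInDistribution (fun (n : ℕ) ω => (√n)⁻¹ * lagSum f f h n (fun i => Y i ω)) atTop Z
      (fun _ => P) P' := by
  have hmY : Measurable fun ω i => Y i ω := measurable_pi_lambda _ hm
  have hm' : ∀ n : ℕ, Measurable fun ω => (√(n : ℝ))⁻¹ * lagSum f f h n (fun i => Y i ω) :=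
    fun n => ((measurable_lagSum hf hf h n).comp hmY).const_mul _
  refine ⟨fun n => (hm' n).aemeasurable, hZ.aemeasurable, ?_⟩
  refine ProbabilityMeasure.tendsto_iff_tendsto_charFun.2 fun t => ?_
  have h1 := tendsto_integral_exp_lagSum hY hm hf hfK hh hf0 hv t
  have h2 : charFun (P'.map Z) t = Complex.exp (-(v ^ 2 * t ^ 2 / 2) : ℝ) := by
    rw [hZ.map_eq, charFun_gaussianReal, ← hs]
    congr 1
    push_cast; ring
  simp only [ProbabilityMeasure.coe_mk, h2]
  refine h1.congr fun n => ?_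
  rw [charFun_apply_real, integral_map (hm' n).aemeasurable (by fun_prop)]
  simp

end CentralLimit

/-! ### Convergence in probability to constants. -/

section InMeasure

variable {Ω : Type*} [MeasurableSpace Ω] {P : Measure Ω}

lemma tendstoInMeasure_prodMk_const {E E' : Type*} [PseudoMetricSpace E] [PseudoMetricSpace E']
    {U : ℕ → Ω → E} {V : ℕ → Ω → E'} {c : E} {d : E'}
    (hU : TendstoInMeasure P U atTop fun _ => c) (hV : TendstoInMeasure P V atTop fun _ => d) :
    TendstoInMeasure P (fun n ω => (U n ω, V n ω)) atTop fun _ => (c, d) := by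
  rw [tendstoInMeasure_iff_dist] at *
  intro ε hε
  have h := (hU ε hε).add (hV ε hε)
  rw [add_zero] at h
  refine tendsto_of_tendsto_of_tendsto_of_le_of_le tendsto_const_nhds h (fun _ => zero_le) fun n => ?_
  refine (measure_mono fun ω hω => ?_).trans (measure_union_le _ _)
  simpa [Prod.dist_eq] using hω

/-- Convergence in measure to a constant is preserved by maps continuous at that constant. -/
lemma tendstoInMeasure_comp_continuousAt {E F : Type*} [PseudoMetricSpace E] [PseudoMetricSpace F]
    {U : ℕ → Ω → E} {c : E} (hU : TendstoInMeasure P U atTop fun _ => c)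
    {G : E → F} (hG : ContinuousAt G c) :
    TendstoInMeasure P (fun n ω => G (U n ω)) atTop fun _ => G c := by
  rw [tendstoInMeasure_iff_dist] at *
  intro ε hε
  obtain ⟨δ, hδ, h⟩ := Metric.continuousAt_iff.1 hG ε hε
  refine tendsto_of_tendsto_of_tendsto_of_le_of_le tendsto_const_nhds (hU δ hδ)
    (fun _ => zero_le) fun n => measure_mono fun ω hω => ?_
  by_contra hlt
  exact absurd (h (not_le.1 hlt)) (not_lt.2 hω)

/-- A sequence converges in measure to a constant if a power of its distance to the constant is
dominated by integrable functions with integrals tending to zero. -/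
lemma tendstoInMeasure_of_pow_le [IsProbabilityMeasure P] {U G : ℕ → Ω → ℝ} {c : ℝ} {k : ℕ}
    (hUG : ∀ n ω, |U n ω - c| ^ k ≤ G n ω) (hi : ∀ n, Integrable (G n) P)
    {b : ℕ → ℝ} (hGb : ∀ᶠ n in atTop, ∫ ω, G n ω ∂P ≤ b n) (hb : Tendsto b atTop (𝓝 0)) :
    TendstoInMeasure P U atTop fun _ => c := by
  rw [tendstoInMeasure_iff_measureReal_norm]
  intro ε hε
  have hk : 0 < ε ^ k := pow_pos hε k
  have h0 : Tendsto (fun n => b n / ε ^ k) atTop (𝓝 0) := by simpa using hb.div_const (ε ^ k)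
  refine squeeze_zero' (Eventually.of_forall fun n => measureReal_nonneg) ?_ h0
  filter_upwards [hGb] with n hn
  rw [le_div_iff₀' hk]
  have h1 := mul_meas_ge_le_integral_of_nonneg (μ := P) (f := G n)
    (ae_of_all _ fun ω => (pow_nonneg (abs_nonneg _) k).trans (hUG n ω)) (hi n) (ε ^ k)
  refine le_trans ?_ (h1.trans hn)
  exact mul_le_mul_of_nonneg_left (measureReal_mono fun ω hω =>
    (pow_le_pow_left₀ hε.le hω k).trans (hUG n ω)) hk.le

end InMeasure

section LagInMeasure

variable {Ω : Type*} [MeasurableSpace Ω] {P : Measure Ω} [IsProbabilityMeasure P]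
  {Y : ℕ → Ω → ℝ} {f g : ℝ → ℝ} {K L : ℝ} {h : ℕ}

lemma integrable_lagSum_sub_sq (hm : ∀ i, Measurable (Y i))
    (hf : Measurable f) (hg : Measurable g) (hfK : ∀ x, |f x| ≤ K) (hgL : ∀ x, |g x| ≤ L)
    (n : ℕ) (c : ℝ) : Integrable (fun ω => (lagSum f g h n (fun i => Y i ω) - c) ^ 2) P := by
  have hmY : Measurable fun ω i => Y i ω := measurable_pi_lambda _ hm
  refine Integrable.of_bound ((((measurable_lagSum hf hg h n).comp hmY).sub_const
    _).pow_const 2).aestronglyMeasurable ((n * (K * L) + |c|) ^ 2) (ae_of_all _ fun ω => ?_)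
  rw [norm_pow]
  refine pow_le_pow_left₀ (norm_nonneg _) ((norm_sub_le _ _).trans ?_) 2
  exact add_le_add (abs_lagSum_le hfK hgL h n _) le_rfl

/-- Weak law of large numbers for lag products. -/
lemma tendstoInMeasure_lagSum_div (hY : iIndepFun Y P) (hm : ∀ i, Measurable (Y i))
    (hf : Measurable f) (hg : Measurable g) (hfK : ∀ x, |f x| ≤ K) (hgL : ∀ x, |g x| ≤ L)
    (hh : 1 ≤ h) {a b : ℝ} (hfa : ∀ i, ∫ ω, f (Y i ω) ∂P = a)
    (hgb : ∀ i, ∫ ω, g (Y i ω) ∂P = b) :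
    TendstoInMeasure P (fun (n : ℕ) ω => lagSum f g h n (fun i => Y i ω) / n) atTop
      fun _ => a * b := by
  obtain ⟨C, hC, hCn⟩ := exists_integral_lagSum_sub_sq_le hY hm hf hg hfK hgL hh hfa hgb
  refine tendstoInMeasure_of_pow_le (k := 2)
    (G := fun n ω => (lagSum f g h n (fun i => Y i ω) / n - a * b) ^ 2) (b := fun n => C / n)
    (fun n ω => (sq_abs _).le) (fun n => ?_) ?_ (tendsto_const_div_atTop_nhds_zero_nat C)
  -- For `n = 0` the quotient is `0`, so the integrand is constant.
  · rcases Nat.eq_zero_or_pos n with rfl | hn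
    · simpa using integrable_const _
    · have hn' : (n : ℝ) ≠ 0 := by positivity
      refine ((integrable_lagSum_sub_sq (P := P) (h := h) hm hf hg hfK hgL n
        (n * (a * b))).div_const ((n : ℝ) ^ 2)).congr (ae_of_all _ fun ω => ?_)
      simp only
      field_simp
  · filter_upwards [eventually_gt_atTop 0] with n hn
    have hn' : (0 : ℝ) < n := by exact_mod_cast hn
    have e : ∀ ω, (lagSum f g h n (fun i => Y i ω) / n - a * b) ^ 2 =
        (lagSum f g h n (fun i => Y i ω) - n * (a * b)) ^ 2 / (n : ℝ) ^ 2 := fun ω => by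
      field_simp
    simp only [e]
    rw [integral_div, div_le_iff₀ (by positivity)]
    refine (hCn n).trans (le_of_eq ?_)
    field_simp

/-- Controls the effect of estimating the means. Each lag sum has a centered factor, hence `L²` norm
of order `√n`; by `2|a b| ≤ a² + b²` the product of the averages is of order `1 / n` in `L¹`, which
beats the factor `√n`. -/
lemma tendstoInMeasure_sqrt_mul_lagSum_mul (hY : iIndepFun Y P) (hm : ∀ i, Measurable (Y i))
    (hf : Measurable f) (hg : Measurable g) (hfK : ∀ x, |f x| ≤ K) (hgL : ∀ x, |g x| ≤ L)
    (hh : 1 ≤ h) (hf0 : ∀ i, ∫ ω, f (Y i ω) ∂P = 0) :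
    TendstoInMeasure P (fun (n : ℕ) ω => √n * ((lagSum f g h n (fun i => Y i ω) / n) *
      (lagSum g f h n (fun i => Y i ω) / n))) atTop fun _ => 0 := by
  have h1 := integral_lagSum_sq_le_of_left hY hm hf hg hfK hgL hh hf0
  have h2 := integral_lagSum_sq_le_of_right hY hm hg hf hgL hfK hh hf0
  have i1 : ∀ n, Integrable (fun ω => (lagSum f g h n (fun i => Y i ω)) ^ 2) P := fun n => by
    simpa using integrable_lagSum_sub_sq (P := P) (h := h) hm hf hg hfK hgL n 0
  have i2 : ∀ n, Integrable (fun ω => (lagSum g f h n (fun i => Y i ω)) ^ 2) P := fun n => by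
    simpa using integrable_lagSum_sub_sq (P := P) (h := h) hm hg hf hgL hfK n 0
  refine tendstoInMeasure_of_pow_le (k := 1)
    (G := fun n ω => √n / (2 * (n : ℝ) ^ 2) * ((lagSum f g h n (fun i => Y i ω)) ^ 2 +
      (lagSum g f h n (fun i => Y i ω)) ^ 2)) (b := fun n => (K * L) ^ 2 * (√n)⁻¹)
    (fun n ω => ?_) (fun n => ((i1 n).add (i2 n)).const_mul _) ?_ ?_
  · set a := lagSum f g h n (fun i => Y i ω)
    set b := lagSum g f h n (fun i => Y i ω)
    have e : √(n : ℝ) * (a / n * (b / n)) = √n / (2 * (n : ℝ) ^ 2) * (2 * (a * b)) := by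
      rcases Nat.eq_zero_or_pos n with rfl | hn
      · simp
      · have hn' : (n : ℝ) ≠ 0 := by positivity
        field_simp
    rw [sub_zero, pow_one, e, abs_mul, abs_of_nonneg (by positivity)]
    gcongr
    rw [abs_le]
    constructor <;> nlinarith [sq_nonneg (a + b), sq_nonneg (a - b)]
  · filter_upwards [eventually_gt_atTop 0] with n hn
    have hs : 0 < √(n : ℝ) := Real.sqrt_pos.2 (by exact_mod_cast hn)
    have hss : (n : ℝ) = √n ^ 2 := (Real.sq_sqrt (Nat.cast_nonneg n)).symm
    rw [integral_const_mul, integral_add (i1 n) (i2 n)]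
    calc _ ≤ √n / (2 * (n : ℝ) ^ 2) * (n * (K * L) ^ 2 + n * (L * K) ^ 2) := by
          gcongr
          · exact h1 n
          · exact h2 n
      _ = _ := by
          rw [hss, Real.sqrt_sq hs.le]
          field_simp
          ring
  · simpa using (tendsto_inv_atTop_zero.comp (Real.tendsto_sqrt_atTop.comp
      tendsto_natCast_atTop_atTop)).const_mul ((K * L) ^ 2)

end LagInMeasure

/-! ### The estimator as a function of lag averages. -/

section SampleAlgebra

lemma indicator_prod_one (S : Set ℝ) (x y : ℝ) :
    (S ×ˢ S).indicator (fun _ => (1 : ℝ)) (x, y) =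
      S.indicator (fun _ => (1 : ℝ)) x * S.indicator (fun _ => (1 : ℝ)) y := by
  by_cases hx : x ∈ S <;> by_cases hy : y ∈ S <;> simp [hx, hy]

/-- Weighted covariances are translation invariant. The reference point `m` is free, and will be the
population conditional mean. -/
lemma weighted_covariance_eq {n : ℕ} (κ x y : Fin n → ℝ) (m : ℝ) (hN : ∑ i, κ i ≠ 0) :
    (1 / ∑ i, κ i) * ∑ i, ((x i - (1 / ∑ i, κ i) * ∑ i, x i * κ i) *
      (y i - (1 / ∑ i, κ i) * ∑ i, y i * κ i)) * κ i =
    (∑ i, (x i - m) * (y i - m) * κ i - (∑ i, (x i - m) * κ i) * (∑ i, (y i - m) * κ i) /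
      ∑ i, κ i) / ∑ i, κ i := by
  set N := ∑ i, κ i with hNdef
  have hc : ∀ z : Fin n → ℝ, (1 / N) * ∑ i, z i * κ i = m + (∑ i, (z i - m) * κ i) / N := fun z => by
    simp only [sub_mul, Finset.sum_sub_distrib, ← Finset.mul_sum, ← hNdef]
    field_simp
    ring
  rw [hc x, hc y]
  set α := ∑ i, (x i - m) * κ i with hα
  set β := ∑ i, (y i - m) * κ i with hβ
  have : ∑ i, ((x i - (m + α / N)) * (y i - (m + β / N))) * κ i =
      ∑ i, (x i - m) * (y i - m) * κ i - α / N * β - β / N * α + α / N * (β / N) * N := by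
    rw [hNdef, hα, hβ]
    simp only [Finset.mul_sum, ← Finset.sum_sub_distrib, ← Finset.sum_add_distrib]
    exact Finset.sum_congr rfl fun i _ => by ring
  rw [this]
  field_simp
  ring

/-- The weight of a pair factors as `w(x) w(y)`, and `w² = w` lets `w` be absorbed into `f`. The
normalizations by the number of points in the square cancel. -/
lemma sampleCorrelation_eq {n : ℕ} (x y : Fin n → ℝ) (S : Set ℝ) (m : ℝ) (w f : ℝ → ℝ)
    (hw : w = S.indicator fun _ => 1) (hf : f = fun x => (x - m) * w x) :
    sampleCorrelation x y (S ×ˢ S) =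
      (∑ i, f (x i) * f (y i) - (∑ i, f (x i) * w (y i)) * (∑ i, w (x i) * f (y i)) /
        ∑ i, w (x i) * w (y i)) /
      √((∑ i, f (x i) ^ 2 * w (y i) - (∑ i, f (x i) * w (y i)) ^ 2 / ∑ i, w (x i) * w (y i)) *
        (∑ i, w (x i) * f (y i) ^ 2 - (∑ i, w (x i) * f (y i)) ^ 2 / ∑ i, w (x i) * w (y i))) := by
  have hw2 : ∀ x, w x ^ 2 = w x := fun x => by
    rw [hw]; by_cases hx : x ∈ S <;> simp [hx]
  have hw0 : ∀ x, 0 ≤ w x := fun x => by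
    rw [hw]; exact indicator_nonneg (fun _ _ => zero_le_one) x
  set κ : Fin n → ℝ := fun i => w (x i) * w (y i) with hκ
  have hind : ∀ i, (S ×ˢ S).indicator (fun _ => (1 : ℝ)) (x i, y i) = κ i := fun i => by
    rw [indicator_prod_one, hκ, hw]
  have e1 : ∑ i, f (x i) * f (y i) = ∑ i, (x i - m) * (y i - m) * κ i :=
    Finset.sum_congr rfl fun i _ => by simp only [hf, hκ]; ring
  have e2 : ∑ i, f (x i) * w (y i) = ∑ i, (x i - m) * κ i :=
    Finset.sum_congr rfl fun i _ => by simp only [hf, hκ]; ring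
  have e3 : ∑ i, w (x i) * f (y i) = ∑ i, (y i - m) * κ i :=
    Finset.sum_congr rfl fun i _ => by simp only [hf, hκ]; ring
  have e4 : ∑ i, f (x i) ^ 2 * w (y i) = ∑ i, (x i - m) * (x i - m) * κ i :=
    Finset.sum_congr rfl fun i _ => by simp only [hf, hκ, mul_pow, hw2]; ring
  have e5 : ∑ i, w (x i) * f (y i) ^ 2 = ∑ i, (y i - m) * (y i - m) * κ i :=
    Finset.sum_congr rfl fun i _ => by simp only [hf, hκ, mul_pow, hw2]; ring
  rw [e1, e2, e3, e4, e5]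
  unfold sampleCorrelation sampleCovariance sampleVariance sampleMean sampleCount
  simp only [hind]
  -- With no sample point in the square every weight is zero, and both sides are `0` by the division
  -- convention.
  by_cases hN : ∑ i, κ i = 0
  · have hκ0 : ∀ i, κ i = 0 := fun i =>
      (Finset.sum_eq_zero_iff_of_nonneg fun i _ => mul_nonneg (hw0 _) (hw0 _)).1 hN i
        (Finset.mem_univ i)
    simp [hκ0]
  · simp only [sq (x _ - _), sq (y _ - _)]
    rw [weighted_covariance_eq κ x y m hN, weighted_covariance_eq κ x x m hN,
      weighted_covariance_eq κ y y m hN]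
    have hpos : 0 < ∑ i, κ i :=
      lt_of_le_of_ne (Finset.sum_nonneg fun i _ => mul_nonneg (hw0 _) (hw0 _)) (Ne.symm hN)
    rw [div_mul_div_comm, Real.sqrt_div' _ (mul_self_nonneg _), Real.sqrt_mul_self hpos.le,
      div_div_div_cancel_right₀ hN, sq, sq]

/-- The reciprocal of the normalized standard deviations, as a function of the averages of
`f(x) w(y)`, `w(x) f(y)`, `w(x) w(y)`, `f(x)² w(y)` and `w(x) f(y)²`. -/
noncomputable def invStd (p : ℝ × ℝ × ℝ × ℝ × ℝ) : ℝ :=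
  (√((p.2.2.2.1 - p.1 ^ 2 / p.2.2.1) * (p.2.2.2.2 - p.2.1 ^ 2 / p.2.2.1)))⁻¹

lemma measurable_invStd : Measurable invStd := by
  unfold invStd; fun_prop

lemma continuousAt_invStd {a b c d e : ℝ} (hc : c ≠ 0)
    (hpos : 0 < (d - a ^ 2 / c) * (e - b ^ 2 / c)) : ContinuousAt invStd (a, b, c, d, e) := by
  unfold invStd
  refine ContinuousAt.inv₀ ?_ (Real.sqrt_pos.2 hpos).ne'
  refine ContinuousAt.sqrt ?_
  refine ContinuousAt.mul (ContinuousAt.sub (by fun_prop) ?_) (ContinuousAt.sub (by fun_prop) ?_)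
  · exact ContinuousAt.div (by fun_prop) (by fun_prop) hc
  · exact ContinuousAt.div (by fun_prop) (by fun_prop) hc

/-- The averages of `f(x) w(y)`, `w(x) f(y)`, `w(x) w(y)`, `f(x)² w(y)` and `w(x) f(y)²` over the
lag `h` pairs. -/
noncomputable def lagAverages (f w : ℝ → ℝ) (h n : ℕ) (y : ℕ → ℝ) : ℝ × ℝ × ℝ × ℝ × ℝ :=
  (lagSum f w h n y / n, lagSum w f h n y / n, lagSum w w h n y / n,
    lagSum (fun x => f x ^ 2) w h n y / n, lagSum w (fun x => f x ^ 2) h n y / n)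

lemma measurable_lagAverages {f w : ℝ → ℝ} (hf : Measurable f) (hw : Measurable w) (h n : ℕ) :
    Measurable (lagAverages f w h n) :=
  ((measurable_lagSum hf hw h n).div_const _).prodMk
    (((measurable_lagSum hw hf h n).div_const _).prodMk
      (((measurable_lagSum hw hw h n).div_const _).prodMk
        (((measurable_lagSum (hf.pow_const 2) hw h n).div_const _).prodMk
          ((measurable_lagSum hw (hf.pow_const 2) h n).div_const _))))

/-- The contribution of the estimated means to the studentized lag sum, where `t` is the normalized
product of the deviations of the means. -/
noncomputable def centeringTerm (t : ℝ) (p : ℝ × ℝ × ℝ × ℝ × ℝ) : ℝ := -t / p.2.2.1 * invStd p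

/-- The lag sum of products of `f`, with estimated means and divided by the estimated standard
deviations. -/
noncomputable def studentizedLagSum (f w : ℝ → ℝ) (h n : ℕ) (y : ℕ → ℝ) : ℝ :=
  (√n)⁻¹ * lagSum f f h n y * invStd (lagAverages f w h n y) +
    centeringTerm (√n * ((lagSum f w h n y / n) * (lagSum w f h n y / n))) (lagAverages f w h n y)

/-- Dividing all sums by `n` divides each variance factor by `n`, hence multiplies the reciprocal
root by `n`. The identity also holds when `n`, `N` or the root is zero, since division by zero gives
zero. -/
lemma sqrt_mul_quotient_eq (n : ℕ) (a b c d e N : ℝ) (h0 : n = 0 → c = 0) :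
    √(n : ℝ) * ((c - a * b / N) / √((d - a ^ 2 / N) * (e - b ^ 2 / N))) =
      (√n)⁻¹ * c * invStd (a / n, b / n, N / n, d / n, e / n) +
        -(√n * ((a / n) * (b / n))) / (N / n) * invStd (a / n, b / n, N / n, d / n, e / n) := by
  rcases Nat.eq_zero_or_pos n with rfl | hn
  · simp
  · have hs : 0 < √(n : ℝ) := Real.sqrt_pos.2 (by exact_mod_cast hn)
    have hn' : (0 : ℝ) < n := by exact_mod_cast hn
    have hss : (n : ℝ) = √n ^ 2 := (Real.sq_sqrt (Nat.cast_nonneg n)).symm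
    have hq : ∀ u v : ℝ, v / n - (u / n) ^ 2 / (N / n) = (v - u ^ 2 / N) / n := fun u v => by
      rcases eq_or_ne N 0 with rfl | hN
      · simp
      · field_simp
    have hG : invStd (a / n, b / n, N / n, d / n, e / n) =
        n / √((d - a ^ 2 / N) * (e - b ^ 2 / N)) := by
      simp only [invStd, hq]
      rw [div_mul_div_comm, Real.sqrt_div' _ (mul_self_nonneg _), Real.sqrt_mul_self hn'.le, inv_div]
    rw [hG]
    set D := √((d - a ^ 2 / N) * (e - b ^ 2 / N))
    set r := √(n : ℝ)
    rw [hss]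
    rcases eq_or_ne N 0 with rfl | hN
    · simp
      field_simp
    · rcases eq_or_ne D 0 with hD | hD
      · simp [hD]
      · field_simp
        ring

end SampleAlgebra

/-! ### The population autocorrelation vanishes. -/

section PopulationZero

variable {Ω : Type*} [MeasurableSpace Ω] {P : Measure Ω}

lemma mean_prod_eq {U V : Ω → ℝ} (hU : Measurable U) (hV : Measurable V) {S : Set ℝ}
    (hS : MeasurableSet S) (Z : Ω → ℝ) :
    mean P U V (S ×ˢ S) Z = (P.real {ω | (U ω, V ω) ∈ S ×ˢ S})⁻¹ *
      ∫ ω, Z ω * (S.indicator (fun _ => (1 : ℝ)) (U ω) * S.indicator (fun _ => (1 : ℝ)) (V ω)) ∂P := by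
  have hA : MeasurableSet {ω | (U ω, V ω) ∈ S ×ˢ S} := (hU.prodMk hV) (hS.prod hS)
  rw [mean, ProbabilityTheory.cond, integral_smul_measure, ← integral_indicator hA, smul_eq_mul,
    ENNReal.toReal_inv]
  congr 2
  ext ω
  rw [← indicator_prod_one]
  by_cases h : (U ω, V ω) ∈ S ×ˢ S
  · rw [indicator_of_mem h, indicator_of_mem (by exact h), mul_one]
  · rw [indicator_of_notMem h, indicator_of_notMem (by exact h), mul_zero]

variable [IsProbabilityMeasure P]

/-- Independent variables are conditionally uncorrelated on a square. -/
lemma correlation_eq_zero_of_indepFun {U V : Ω → ℝ} (hU : Measurable U) (hV : Measurable V)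
    (hUV : IndepFun U V P) {S : Set ℝ} (hS : MeasurableSet S) {K : ℝ} (hK : ∀ x ∈ S, |x| ≤ K) :
    correlation P U V (S ×ˢ S) = 0 := by
  set w : ℝ → ℝ := S.indicator fun _ => 1 with hw
  have hwm : Measurable w := measurable_const.indicator hS
  have hprod : ∀ f g : ℝ → ℝ, Measurable f → Measurable g →
      ∫ ω, f (U ω) * g (V ω) ∂P = (∫ ω, f (U ω) ∂P) * ∫ ω, g (V ω) ∂P := fun f g hf hg =>
    (hUV.comp hf hg).integral_fun_mul_eq_mul_integral (hf.comp hU).aestronglyMeasurable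
      (hg.comp hV).aestronglyMeasurable
  have hA : P.real {ω | (U ω, V ω) ∈ S ×ˢ S} = (∫ ω, w (U ω) ∂P) * ∫ ω, w (V ω) ∂P := by
    have hAm : MeasurableSet {ω | (U ω, V ω) ∈ S ×ˢ S} := (hU.prodMk hV) (hS.prod hS)
    rw [← hprod w w hwm hwm, ← integral_indicator_one hAm]
    congr 1
    ext ω
    rw [hw, ← indicator_prod_one]
    rfl
  set μU := mean P U V (S ×ˢ S) U with hμU
  set μV := mean P U V (S ×ˢ S) V
  -- By independence the `V`-factor appears in numerator and denominator, so `μU` is the mean of `U`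
  -- given `U ∈ S` alone.
  have hmU : μU = ((∫ ω, w (U ω) ∂P) * ∫ ω, w (V ω) ∂P)⁻¹ *
      ((∫ ω, U ω * w (U ω) ∂P) * ∫ ω, w (V ω) ∂P) := by
    rw [hμU, mean_prod_eq hU hV hS, hA, ← hprod (fun x => x * w x) w (by fun_prop) hwm]
    simp only [mul_assoc, hw]
  suffices hc : covariance P U V (S ×ˢ S) = 0 by rw [correlation, hc, zero_div]
  rw [covariance, mean_prod_eq hU hV hS, hA]
  have e : ∫ ω, (U ω - μU) * (V ω - μV) * (w (U ω) * w (V ω)) ∂P =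
      (∫ ω, (U ω - μU) * w (U ω) ∂P) * ∫ ω, (V ω - μV) * w (V ω) ∂P := by
    rw [← hprod (fun x => (x - μU) * w x) (fun x => (x - μV) * w x) (by fun_prop) (by fun_prop)]
    congr 1; ext ω; ring
  rw [e]
  rcases eq_or_ne ((∫ ω, w (U ω) ∂P) * ∫ ω, w (V ω) ∂P) 0 with h0 | h0
  · rw [h0]; simp
  · have hw1 : ∀ x, |w x| ≤ 1 := fun x => by
      rw [hw]; by_cases hx : x ∈ S <;> simp [hx]
    have hi1 : Integrable (fun ω => w (U ω)) P :=
      Integrable.of_bound (hwm.comp hU).aestronglyMeasurable 1 (ae_of_all _ fun ω => hw1 _)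
    have hi2 : Integrable (fun ω => U ω * w (U ω)) P := by
      refine Integrable.of_bound (hU.mul (hwm.comp hU)).aestronglyMeasurable |K|
        (ae_of_all _ fun ω => ?_)
      by_cases hx : U ω ∈ S
      · simpa [hw, hx] using (hK _ hx).trans (le_abs_self K)
      · simp [hw, hx]
    -- One vanishing factor is enough for the covariance, so `μV` needs no computation.
    have hz : ∫ ω, (U ω - μU) * w (U ω) ∂P = 0 := by
      simp only [sub_mul]
      rw [integral_sub hi2 (hi1.const_mul _), integral_const_mul, hmU]
      field_simp [left_ne_zero_of_mul h0, right_ne_zero_of_mul h0]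
      simp
    rw [hz]; simp

end PopulationZero

/-! ### Non-degeneracy of the truncated distribution. -/

section Positivity

variable {ν : Measure ℝ} [IsProbabilityMeasure ν]

lemma measure_Ioc_pos_of_cdf_lt {a b : ℝ} (hab : cdf ν a < cdf ν b) : 0 < ν (Ioc a b) := by
  rw [← measure_cdf ν, StieltjesFunction.measure_Ioc]
  simpa using hab

/-- A distribution whose distribution function increases on both sides of an intermediate point
does not concentrate at one point of the interval. -/
lemma integral_sq_indicator_pos {a b c : ℝ} (hac : cdf ν a < cdf ν c) (hcb : cdf ν c < cdf ν b)
    (m : ℝ) :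
    0 < ∫ x, ((x - m) * (Icc a b).indicator (fun _ => (1 : ℝ)) x) ^ 2 ∂ν := by
  have hac' : a < c := (cdf ν).mono.reflect_lt hac
  have hcb' : c < b := (cdf ν).mono.reflect_lt hcb
  have hm : Measurable fun x : ℝ => ((x - m) * (Icc a b).indicator (fun _ => (1 : ℝ)) x) ^ 2 :=
    ((measurable_id.sub_const m).mul (measurable_const.indicator measurableSet_Icc)).pow_const 2
  have hi : Integrable (fun x : ℝ => ((x - m) * (Icc a b).indicator (fun _ => (1 : ℝ)) x) ^ 2) ν := by
    refine Integrable.of_bound hm.aestronglyMeasurable ((|a| + |b| + |m|) ^ 2)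
      (ae_of_all _ fun x => ?_)
    rw [norm_pow]
    refine pow_le_pow_left₀ (norm_nonneg _) ?_ 2
    by_cases hx : x ∈ Icc a b
    · simp only [indicator_of_mem hx, mul_one]
      refine (abs_sub _ _).trans ?_
      gcongr
      rw [abs_le]
      constructor <;>
        linarith [hx.1, hx.2, neg_abs_le a, le_abs_self b, abs_nonneg a, abs_nonneg b]
    · simp only [indicator_of_notMem hx, mul_zero, norm_zero]
      positivity
  rw [integral_pos_iff_support_of_nonneg (fun x => sq_nonneg _) hi]
  -- The point `m` misses one of `(a, c]` and `(c, b]`, and both have positive mass.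
  rcases le_or_gt m c with hmc | hmc
  · refine (measure_Ioc_pos_of_cdf_lt hcb).trans_le (measure_mono fun x hx => ?_)
    have hx' : x ∈ Icc a b := ⟨(hac'.trans hx.1).le, hx.2⟩
    simpa [hx'] using sub_ne_zero.2 (hmc.trans_lt hx.1).ne'
  · refine (measure_Ioc_pos_of_cdf_lt hac).trans_le (measure_mono fun x hx => ?_)
    have hx' : x ∈ Icc a b := ⟨hx.1.le, (hx.2.trans hcb'.le)⟩
    simpa [hx'] using sub_ne_zero.2 (hx.2.trans_lt hmc).ne

end Positivity

/-! ### Slutsky's theorem and the conclusion. -/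

section Estimator

/-- Sample times start at `1` and lag sums at index `0`, whence the shifted sequence `X (i + 1)`. -/
lemma autocorrEstimator_eq {Ω : Type*} (X : ℤ → Ω → ℝ) (S : Set ℝ) (h n : ℕ) (m : ℝ) (w f : ℝ → ℝ)
    (hw : w = S.indicator fun _ => 1) (hf : f = fun x => (x - m) * w x) (ω : Ω) :
    √n * autocorrEstimator X (S ×ˢ S) h n ω =
      studentizedLagSum f w h n fun i => X ((i : ℤ) + 1) ω := by
  have hl : ∀ u v : ℝ → ℝ, ∑ i : Fin n, u (X (((i : ℕ) : ℤ) + 1) ω) *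
      v (X (((i : ℕ) : ℤ) + 1 + (h : ℤ)) ω) = lagSum u v h n fun i => X ((i : ℤ) + 1) ω := by
    intro u v
    rw [lagSum, Finset.sum_range]
    refine Finset.sum_congr rfl fun i _ => ?_
    push_cast
    rw [add_right_comm]
  rw [autocorrEstimator, sampleCorrelation_eq _ _ S m w f hw hf, hl f f, hl f w, hl w f, hl w w,
    hl (fun x => f x ^ 2) w, hl w (fun x => f x ^ 2)]
  refine sqrt_mul_quotient_eq n _ _ _ _ _ _ ?_
  rintro rfl
  simp [lagSum]

variable {Ω : Type*} [MeasurableSpace Ω] {P : Measure Ω} [IsProbabilityMeasure P]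

/-- Asymptotic normality of the studentized lag sum of a centered bounded function. -/
lemma exists_tendstoInDistribution_studentizedLagSum {Y : ℕ → Ω → ℝ} {w f : ℝ → ℝ} {K c v : ℝ}
    {h : ℕ} (hY : iIndepFun Y P) (hm : ∀ i, Measurable (Y i)) (hwm : Measurable w)
    (hfm : Measurable f) (hw1 : ∀ x, |w x| ≤ 1) (hfK : ∀ x, |f x| ≤ K) (hh : 1 ≤ h)
    (hwc : ∀ i, ∫ ω, w (Y i ω) ∂P = c) (hf0 : ∀ i, ∫ ω, f (Y i ω) ∂P = 0)
    (hfv : ∀ i, ∫ ω, f (Y i ω) ^ 2 ∂P = v) (hc : 0 < c) (hv : 0 < v) :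
    ∃ τ : ℝ≥0, 0 < τ ∧ TendstoInDistribution
      (fun (n : ℕ) ω => studentizedLagSum f w h n fun i => Y i ω) atTop (fun x : ℝ => x)
      (fun _ => P) (gaussianReal 0 τ) := by
  have hf2m : Measurable fun x => f x ^ 2 := hfm.pow_const 2
  have hf2K : ∀ x, |f x ^ 2| ≤ K ^ 2 := fun x => by
    rw [abs_pow]; exact pow_le_pow_left₀ (abs_nonneg _) (hfK x) 2
  have hmY : Measurable fun ω i => Y i ω := measurable_pi_lambda _ hm
  have hvec : TendstoInMeasure P (fun (n : ℕ) ω => lagAverages f w h n fun i => Y i ω) atTop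
      fun _ => (0 * c, c * 0, c * c, v * c, c * v) :=
    tendstoInMeasure_prodMk_const
    (tendstoInMeasure_lagSum_div hY hm hfm hwm hfK hw1 hh hf0 hwc)
    (tendstoInMeasure_prodMk_const
      (tendstoInMeasure_lagSum_div hY hm hwm hfm hw1 hfK hh hwc hf0)
      (tendstoInMeasure_prodMk_const
        (tendstoInMeasure_lagSum_div hY hm hwm hwm hw1 hw1 hh hwc hwc)
        (tendstoInMeasure_prodMk_const
          (tendstoInMeasure_lagSum_div hY hm hf2m hwm hf2K hw1 hh hfv hwc)
          (tendstoInMeasure_lagSum_div hY hm hwm hf2m hw1 hf2K hh hwc hfv))))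
  rw [zero_mul, mul_zero] at hvec
  have hcont : ContinuousAt invStd ((0 : ℝ), (0 : ℝ), c * c, v * c, c * v) :=
    continuousAt_invStd (by positivity) (by simp; positivity)
  have hval : invStd ((0 : ℝ), (0 : ℝ), c * c, v * c, c * v) = (v * c)⁻¹ := by
    have : v * c * (c * v) = (v * c) * (v * c) := by ring
    simp only [invStd]
    rw [zero_pow two_ne_zero, zero_div, sub_zero, sub_zero, this, Real.sqrt_mul_self (by positivity)]
  have hG := tendstoInMeasure_comp_continuousAt hvec hcont
  rw [hval] at hG
  have hT := tendstoInMeasure_prodMk_const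
    (tendstoInMeasure_sqrt_mul_lagSum_mul hY hm hfm hwm hfK hw1 hh hf0) hvec
  have hR := tendstoInMeasure_comp_continuousAt hT
    (G := fun p : ℝ × ℝ × ℝ × ℝ × ℝ × ℝ => centeringTerm p.1 p.2) (by
      refine ContinuousAt.mul (ContinuousAt.div (by fun_prop) (by fun_prop) ?_)
        (ContinuousAt.comp (g := invStd) (f := Prod.snd) hcont continuousAt_snd)
      simp; positivity)
  have hR0 : centeringTerm 0 ((0 : ℝ), (0 : ℝ), c * c, v * c, c * v) = 0 := by simp [centeringTerm]
  simp only [hR0] at hR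
  have hGm : ∀ n : ℕ, Measurable fun ω => invStd (lagAverages f w h n fun i => Y i ω) := fun n =>
    measurable_invStd.comp ((measurable_lagAverages hfm hwm h n).comp hmY)
  have hRm : ∀ n : ℕ, Measurable fun ω => centeringTerm
      (√(n : ℝ) * ((lagSum f w h n (fun i => Y i ω) / n) * (lagSum w f h n (fun i => Y i ω) / n)))
      (lagAverages f w h n fun i => Y i ω) := fun n => by
    have h1 := (measurable_lagSum hfm hwm h n).comp hmY
    have h2 := (measurable_lagSum hwm hfm h n).comp hmY
    have h3 := (measurable_lagAverages hfm hwm h n).comp hmY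
    exact ((((h1.div_const _).mul (h2.div_const _)).const_mul _).neg.div h3.snd.snd.fst).mul (hGm n)
  -- The lag sum has limiting variance `v²` and is multiplied by a factor tending to `(v c)⁻¹`.
  set τ : ℝ≥0 := ⟨(c ^ 2)⁻¹, by positivity⟩ with hτ
  have hτc : (τ : ℝ) = (c ^ 2)⁻¹ := rfl
  refine ⟨τ, ?_, ?_⟩
  · rw [← NNReal.coe_pos, hτc]
    positivity
  have hid : HasLaw (fun x : ℝ => x) (gaussianReal 0 τ) (gaussianReal 0 τ) :=
    ⟨by fun_prop, Measure.map_id⟩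
  -- The Gaussian limit of the lag sum is represented as `v c` times a variable of law `gaussianReal
  -- 0 τ`, so that the Slutsky factor `(v c)⁻¹` returns that variable itself.
  have hlaw := gaussianReal_mul_const hid (v * c)
  rw [mul_zero] at hlaw
  have hclt := tendstoInDistribution_lagSum hY hm hfm hfK hh hf0 hfv (by
    rw [NNReal.coe_mul, NNReal.coe_mk, hτc]
    field_simp) hlaw
  have h1 := hclt.continuous_comp_prodMk_of_tendstoInMeasure_const
    (g := fun p : ℝ × ℝ => p.1 * p.2) (by fun_prop) hG fun n => (hGm n).aemeasurable
  have h2 := h1.add_of_tendstoInMeasure_const hR fun n => (hRm n).aemeasurable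
  refine h2.congr (fun n => Eventually.of_forall fun ω => ?_) (Eventually.of_forall fun x => ?_)
  · simp only [Pi.add_apply, studentizedLagSum]
  · simp only
    field_simp
    simp

end Estimator

end CondCorr

theorem mainTheorem4 {Ω : Type*} [MeasurableSpace Ω] (P : Measure Ω) [IsProbabilityMeasure P]
    (X : ℤ → Ω → ℝ) (hmeas : ∀ t, Measurable (X t))
    (hindep : iIndepFun X P) (hident : ∀ s t, IdentDistrib (X s) (X t) P P)
    (Q : ℝ → ℝ) (hQ : ∀ t, CondCorr.IsInverseCDF (cdf (P.map (X t))) Q)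
    (p q : ℝ) (hp : 0 < p) (hpq : p < q) (hq : q < 1)
    (h : ℕ) (hh : 1 ≤ h) :
    ∃ τ : ℝ≥0, 0 < τ ∧ ∀ t : ℤ,
      TendstoInDistribution
        (fun (n : ℕ) (ω : Ω) => Real.sqrt n *
          (CondCorr.autocorrEstimator X (CondCorr.quantileSquare Q p q) h n ω
            - CondCorr.autocorr P X (CondCorr.quantileSquare Q p q) t h))
        atTop (fun x : ℝ => x) (fun _ => P) (gaussianReal 0 τ) := by
  set S : Set ℝ := Icc (Q p) (Q q) with hS
  have hSK : ∀ x ∈ S, |x| ≤ |Q p| + |Q q| := fun x hx => by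
    rw [abs_le]
    constructor <;> linarith [hx.1, hx.2, neg_abs_le (Q p), le_abs_self (Q q), abs_nonneg (Q p),
      abs_nonneg (Q q)]
  have hzero : ∀ t, CondCorr.autocorr P X (CondCorr.quantileSquare Q p q) t h = 0 := fun t =>
    CondCorr.correlation_eq_zero_of_indepFun (hmeas _) (hmeas _)
      (hindep.indepFun (by omega)) measurableSet_Icc hSK
  simp only [hzero, sub_zero]
  set ν : Measure ℝ := P.map (X 0) with hν
  have : IsProbabilityMeasure ν := Measure.isProbabilityMeasure_map (hmeas 0).aemeasurable
  have hF : ∀ u ∈ Ioo (0 : ℝ) 1, cdf ν (Q u) = u := fun u hu => (hQ 0 u hu (Q u)).2 rfl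
  have hFp := hF p ⟨hp, hpq.trans hq⟩
  have hFq := hF q ⟨hp.trans hpq, hq⟩
  -- Any level strictly between `p` and `q` would do: it shows that the distribution has mass on
  -- both sides of an interior quantile, which makes `v` positive.
  have hFm := hF ((p + q) / 2) ⟨by linarith, by linarith⟩
  have hint : ∀ u : ℝ → ℝ, Measurable u → ∀ t, ∫ ω, u (X t ω) ∂P = ∫ x, u x ∂ν := fun u hu t => by
    rw [hν, integral_map (hmeas 0).aemeasurable hu.aestronglyMeasurable]
    exact ((hident t 0).comp hu).integral_eq
  set w : ℝ → ℝ := S.indicator fun _ => 1 with hw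
  have hwm : Measurable w := measurable_const.indicator measurableSet_Icc
  have hw1 : ∀ x, |w x| ≤ 1 := fun x => by
    rw [hw]; by_cases hx : x ∈ S <;> simp [hx]
  have hc : 0 < ∫ x, w x ∂ν := by
    have e : ∫ x, w x ∂ν = ν.real S := integral_indicator_one measurableSet_Icc
    rw [e, measureReal_def, ENNReal.toReal_pos_iff]
    exact ⟨(CondCorr.measure_Ioc_pos_of_cdf_lt (by rw [hFp, hFq]; exact hpq)).trans_le
      (measure_mono Ioc_subset_Icc_self), measure_lt_top _ _⟩
  -- The mean of `ν` conditioned on `S`, the one choice that makes `f` centered.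
  set m : ℝ := (∫ x, x * w x ∂ν) / ∫ x, w x ∂ν with hm
  set f : ℝ → ℝ := fun x => (x - m) * w x with hf
  have hfm : Measurable f := by fun_prop
  have hxw : ∀ x, |x * w x| ≤ |Q p| + |Q q| := fun x => by
    by_cases hx : x ∈ S
    · simpa [hw, hx] using hSK x hx
    · simp [hw, hx]; positivity
  have hfK : ∀ x, |f x| ≤ |Q p| + |Q q| + |m| := fun x => by
    simp only [hf, sub_mul]
    refine (abs_sub _ _).trans (add_le_add (hxw x) ?_)
    rw [abs_mul]
    exact mul_le_of_le_one_right (abs_nonneg _) (hw1 x)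
  have hf0 : ∫ x, f x ∂ν = 0 := by
    have i1 : Integrable (fun x => x * w x) ν :=
      Integrable.of_bound (measurable_id.mul hwm).aestronglyMeasurable _ (ae_of_all _ hxw)
    have i2 : Integrable w ν := Integrable.of_bound hwm.aestronglyMeasurable _ (ae_of_all _ hw1)
    simp only [hf, sub_mul]
    rw [integral_sub i1 (i2.const_mul _), integral_const_mul, hm, div_mul_cancel₀ _ hc.ne', sub_self]
  have hv : 0 < ∫ x, f x ^ 2 ∂ν :=
    CondCorr.integral_sq_indicator_pos (c := Q ((p + q) / 2)) (by rw [hFp, hFm]; linarith)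
      (by rw [hFq, hFm]; linarith) m
  obtain ⟨τ, hτ, hlim⟩ := CondCorr.exists_tendstoInDistribution_studentizedLagSum
    (Y := fun i : ℕ => X ((i : ℤ) + 1)) (w := w) (f := f)
    (hindep.precomp (g := fun i : ℕ => (i : ℤ) + 1) fun i j hij => by simpa using hij)
    (fun i => hmeas _) hwm hfm hw1 hfK hh (fun i => hint w hwm _)
    (fun i => (hint f hfm _).trans hf0) (fun i => hint _ (hfm.pow_const 2) _) hc hv
  refine ⟨τ, hτ, fun _ => hlim.congr (fun n => Eventually.of_forall fun ω => ?_)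
    Filter.EventuallyEq.rfl⟩
  exact (CondCorr.autocorrEstimator_eq X S h n m w f hw hf ω).symm
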